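/- Let $\mathcal C$ be a braided monoidal category with equalizers and coequalizers, with tensor product $\otimes$, unit object $K$ and braiding $c$; associativity and unit constraints are suppressed, and an object also denotes its identity morphism. Let $H$ be an object with a unital magma structure ($\eta:K\to H$, $\mu:H\otimes H\to H$ with $\mu\circ(\eta\otimes H)=\mathrm{id}_H=\mu\circ(H\otimes\eta)$) and a comonoid structure (counit $\varepsilon:H\to K$, coassociative coproduct $\delta:H\to H\otimes H$) such that (a1) $\delta\circ\mu=(\mu\otimes\mu)\circ(H\otimes c_{H,H}\otimes H)\circ(\delta\otimes\delta)$; (a2) $\varepsilon\circ\mu\circ(\mu\otimes H)=\varepsilon\circ\mu\circ(H\otimes\mu)=((\varepsilon\circ\mu)\otimes(\varepsilon\circ\mu))\circ(H\otimes\delta\otimes H)=((\varepsilon\circ\mu)\otimes(\varepsilon\circ\mu))\circ(H\otimes(c_{H,H}^{-1}\circ\delta)\otimes H)$; (a3) $(\delta\otimes H)\circ\delta\circ\eta=(H\otimes\mu\otimes H)\circ((\delta\circ\eta)\otimes(\delta\circ\eta))=(H\otimes(\mu\circ c_{H,H}^{-1})\otimes H)\circ((\delta\circ\eta)\otimes(\delta\circ\eta))$.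 Put $\Pi^L=((\varepsilon\circ\mu)\otimes H)\circ(H\otimes c_{H,H})\circ((\delta\circ\eta)\otimes H)$ and $\Pi^R=(H\otimes(\varepsilon\circ\mu))\circ(c_{H,H}\otimes H)\circ(H\otimes(\delta\circ\eta))$, and write $u*v=\mu\circ(u\otimes v)\circ\delta$ for $u,v:H\to H$. $H$ is called a weak Hopf quasigroup if moreover there is $\lambda:H\to H$ with $\Pi^L=\mathrm{id}_H*\lambda$; $\Pi^R=\lambda*\mathrm{id}_H$; $\lambda*\Pi^L=\Pi^R*\lambda=\lambda$; $\mu\circ(\lambda\otimes\mu)\circ(\delta\otimes H)=\mu\circ(\Pi^R\otimes H)$; $\mu\circ(H\otimes\mu)\circ(H\otimes\lambda\otimes H)\circ(\delta\otimes H)=\mu\circ(\Pi^L\otimes H)$; $\mu\circ(\mu\otimes\lambda)\circ(H\otimes\delta)=\mu\circ(H\otimes\Pi^L)$; $\mu\circ(\mu\otimes H)\circ(H\otimes\lambda\otimes H)\circ(H\otimes\delta)=\mu\circ(H\otimes\Pi^R)$. For $\sigma\in\{L,R\}$ let $\Omega_\sigma^1=(\mu\otimes H)\circ(H\otimes\Pi^\sigma\otimes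 H)\circ(H\otimes\delta)$ and $\Omega_\sigma^2=(H\otimes\mu)\circ(H\otimes\Pi^\sigma\otimes H)\circ(\delta\otimes H)$. Let $\beta=(\mu\otimes H)\circ(H\otimes\delta)$ and $\gamma=(H\otimes\mu)\circ(\delta\otimes H)$ be the right and left Galois morphisms. A morphism $\phi:H\otimes H\to H\otimes H$ is almost left $H$-linear if $\phi=(\mu\otimes H)\circ(H\otimes\phi)\circ(H\otimes\eta\otimes H)$, and almost right $H$-linear if $\phi=(H\otimes\mu)\circ(\phi\otimes H)\circ(H\otimes\eta\otimes H)$. Then the four morphisms $\Omega_\sigma^\alpha$ ($\sigma\in\{L,R\}$, $\alpha\in\{1,2\}$) are split idempotents, i.e. there are an object $H\times_\sigma^\alpha H$ and morphisms $q_\sigma^\alpha:H\otimes H\to H\times_\sigma^\alpha H$, $j_\sigma^\alpha:H\times_\sigma^\alpha H\to H\otimes H$ with $j_\sigma^\alpha\circ q_\sigma^\alpha=\Omega_\sigma^\alpha$ and $q_\sigma^\alpha\circ j_\sigma^\alpha=\mathrm{id}$; and, for any choice of such splittings, the following are equivalent: (i) $H$ is a weak Hopf quasigroup; (ii) the morphisms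 $f=q_R^1\circ\beta\circ j_L^1:H\times_L^1H\to H\times_R^1H$ and $g=q_L^2\circ\gamma\circ j_R^2:H\times_R^2H\to H\times_L^2H$ are isomorphisms, $j_L^1\circ f^{-1}\circ q_R^1$ is almost left $H$-linear, and $j_R^2\circ g^{-1}\circ q_L^2$ is almost right $H$-linear. -/

import Mathlib

open CategoryTheory
open scoped MonoidalCategory

namespace WeakHopfQuasigroup

open scoped ComonObj

universe v u

variable {C : Type u} [Category.{v} C] [MonoidalCategory C]

/-- A unital magma in a monoidal category: an object with a unit and a (not necessarily
associative) product for which the unit is two-sided. -/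
class UnitalMagmaObj (H : C) where
  /-- the unit -/
  one : 𝟙_ C ⟶ H
  /-- the product -/
  mul : H ⊗ H ⟶ H
  one_mul : one ▷ H ≫ mul = (λ_ H).hom
  mul_one : H ◁ one ≫ mul = (ρ_ H).hom

/-- The unit of a unital magma. -/
abbrev eta (H : C) [UnitalMagmaObj H] : 𝟙_ C ⟶ H := UnitalMagmaObj.one

/-- The product of a unital magma. -/
abbrev mu (H : C) [UnitalMagmaObj H] : H ⊗ H ⟶ H := UnitalMagmaObj.mul

/-- A splitting of an endomorphism `e`: `e = j ∘ q` and `q ∘ j = id`. -/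
structure Splitting {X : C} (e : X ⟶ X) where
  /-- the object through which `e` factors -/
  obj : C
  /-- the projection -/
  q : X ⟶ obj
  /-- the inclusion -/
  j : obj ⟶ X
  q_j : q ≫ j = e
  j_q : j ≫ q = 𝟙 obj

section Linearity

variable (H : C) [UnitalMagmaObj H]

/-- `φ = (μ ⊗ H) ∘ (H ⊗ φ) ∘ (H ⊗ η ⊗ H)`. -/
def AlmostLeftLinear (φ : H ⊗ H ⟶ H ⊗ H) : Prop :=
  φ = H ◁ (λ_ H).inv ≫ H ◁ (eta H ▷ H) ≫ H ◁ φ ≫ (α_ H H H).inv ≫ mu H ▷ H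

/-- `φ = (H ⊗ μ) ∘ (φ ⊗ H) ∘ (H ⊗ η ⊗ H)`. -/
def AlmostRightLinear (φ : H ⊗ H ⟶ H ⊗ H) : Prop :=
  φ = (ρ_ H).inv ▷ H ≫ (H ◁ eta H) ▷ H ≫ φ ▷ H ≫ (α_ H H H).hom ≫ H ◁ mu H

end Linearity

section Galois

variable (H : C) [UnitalMagmaObj H] [ComonObj H]

/-- The convolution product `f ∗ g = μ ∘ (f ⊗ g) ∘ δ`. -/
def conv (f g : H ⟶ H) : H ⟶ H := Δ[H] ≫ (f ⊗ₘ g) ≫ mu H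

/-- The right Galois morphism `(μ ⊗ H) ∘ (H ⊗ δ)`. -/
def rightGalois : H ⊗ H ⟶ H ⊗ H :=
  H ◁ Δ[H] ≫ (α_ H H H).inv ≫ mu H ▷ H

/-- The left Galois morphism `(H ⊗ μ) ∘ (δ ⊗ H)`. -/
def leftGalois : H ⊗ H ⟶ H ⊗ H :=
  Δ[H] ▷ H ≫ (α_ H H H).hom ≫ H ◁ mu H

/-- `(μ ⊗ H) ∘ (H ⊗ p ⊗ H) ∘ (H ⊗ δ)`. -/
def omegaOne (p : H ⟶ H) : H ⊗ H ⟶ H ⊗ H :=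
  H ◁ Δ[H] ≫ H ◁ (p ▷ H) ≫ (α_ H H H).inv ≫ mu H ▷ H

/-- `(H ⊗ μ) ∘ (H ⊗ p ⊗ H) ∘ (δ ⊗ H)`. -/
def omegaTwo (p : H ⟶ H) : H ⊗ H ⟶ H ⊗ H :=
  Δ[H] ▷ H ≫ (H ◁ p) ▷ H ≫ (α_ H H H).hom ≫ H ◁ mu H

end Galois

section Braided

variable [BraidedCategory C] (H : C) [UnitalMagmaObj H] [ComonObj H]

/-- The target morphism
`Π^L = ((ε ∘ μ) ⊗ H) ∘ (H ⊗ c) ∘ ((δ ∘ η) ⊗ H)`. -/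
def piL : H ⟶ H :=
  (λ_ H).inv ≫ (eta H ≫ Δ[H]) ▷ H ≫ (α_ H H H).hom ≫ H ◁ (β_ H H).hom ≫
    (α_ H H H).inv ≫ (mu H ≫ ε[H]) ▷ H ≫ (λ_ H).hom

/-- The source morphism
`Π^R = (H ⊗ (ε ∘ μ)) ∘ (c ⊗ H) ∘ (H ⊗ (δ ∘ η))`. -/
def piR : H ⟶ H :=
  (ρ_ H).inv ≫ H ◁ (eta H ≫ Δ[H]) ≫ (α_ H H H).inv ≫ (β_ H H).hom ▷ H ≫
    (α_ H H H).hom ≫ H ◁ (mu H ≫ ε[H]) ≫ (ρ_ H).hom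

/-- `Ω_L^1`. -/
def omegaL1 : H ⊗ H ⟶ H ⊗ H := omegaOne H (piL H)

/-- `Ω_R^1`. -/
def omegaR1 : H ⊗ H ⟶ H ⊗ H := omegaOne H (piR H)

/-- `Ω_L^2`. -/
def omegaL2 : H ⊗ H ⟶ H ⊗ H := omegaTwo H (piL H)

/-- `Ω_R^2`. -/
def omegaR2 : H ⊗ H ⟶ H ⊗ H := omegaTwo H (piR H)

/-- The axioms (a1), (a2), (a3) on a unital magma and comonoid `H`. -/
structure AxiomsA123 : Prop where
  /-- `δ ∘ μ = (μ ⊗ μ) ∘ δ_{H ⊗ H}` -/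
  a1 : mu H ≫ Δ[H] = ((Δ[H] ⊗ₘ Δ[H]) ≫ MonoidalCategory.tensorμ H H H H) ≫ (mu H ⊗ₘ mu H)
  /-- `ε ∘ μ ∘ (μ ⊗ H) = ε ∘ μ ∘ (H ⊗ μ)` -/
  a2_assoc : mu H ▷ H ≫ mu H ≫ ε[H] =
    (α_ H H H).hom ≫ H ◁ mu H ≫ mu H ≫ ε[H]
  /-- `ε ∘ μ ∘ (μ ⊗ H) = ((ε ∘ μ) ⊗ (ε ∘ μ)) ∘ (H ⊗ δ ⊗ H)` -/
  a2_comul : mu H ▷ H ≫ mu H ≫ ε[H] =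
    (H ◁ Δ[H]) ▷ H ≫ (α_ H H H).inv ▷ H ≫ (α_ (H ⊗ H) H H).hom ≫
      ((mu H ≫ ε[H]) ⊗ₘ (mu H ≫ ε[H])) ≫ (λ_ (𝟙_ C)).hom
  /-- `ε ∘ μ ∘ (μ ⊗ H) = ((ε ∘ μ) ⊗ (ε ∘ μ)) ∘ (H ⊗ (c⁻¹ ∘ δ) ⊗ H)` -/
  a2_braid : mu H ▷ H ≫ mu H ≫ ε[H] =
    (H ◁ (Δ[H] ≫ (β_ H H).inv)) ▷ H ≫ (α_ H H H).inv ▷ H ≫ (α_ (H ⊗ H) H H).hom ≫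
      ((mu H ≫ ε[H]) ⊗ₘ (mu H ≫ ε[H])) ≫ (λ_ (𝟙_ C)).hom
  /-- `(δ ⊗ H) ∘ δ ∘ η = (H ⊗ μ ⊗ H) ∘ ((δ ∘ η) ⊗ (δ ∘ η))` -/
  a3_mul : eta H ≫ Δ[H] ≫ Δ[H] ▷ H =
    (λ_ (𝟙_ C)).inv ≫ ((eta H ≫ Δ[H]) ⊗ₘ (eta H ≫ Δ[H])) ≫
      (α_ (H ⊗ H) H H).inv ≫ (α_ H H H).hom ▷ H ≫ (H ◁ mu H) ▷ H
  /-- `(δ ⊗ H) ∘ δ ∘ η = (H ⊗ (μ ∘ c⁻¹) ⊗ H) ∘ ((δ ∘ η) ⊗ (δ ∘ η))` -/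
  a3_braid : eta H ≫ Δ[H] ≫ Δ[H] ▷ H =
    (λ_ (𝟙_ C)).inv ≫ ((eta H ≫ Δ[H]) ⊗ₘ (eta H ≫ Δ[H])) ≫
      (α_ (H ⊗ H) H H).inv ≫ (α_ H H H).hom ▷ H ≫ (H ◁ ((β_ H H).inv ≫ mu H)) ▷ H

/-- The conditions (a4-1) to (a4-7): `s` is an antipode of `H`. -/
structure IsAntipode (s : H ⟶ H) : Prop where
  /-- `Π^L = id ∗ s` -/
  id_conv : piL H = conv H (𝟙 H) s
  /-- `Π^R = s ∗ id` -/
  conv_id : piR H = conv H s (𝟙 H)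
  /-- `s ∗ Π^L = s` -/
  conv_piL : conv H s (piL H) = s
  /-- `Π^R ∗ s = s` -/
  piR_conv : conv H (piR H) s = s
  /-- `μ ∘ (s ⊗ μ) ∘ (δ ⊗ H) = μ ∘ (Π^R ⊗ H)` -/
  a4_4 : Δ[H] ▷ H ≫ (α_ H H H).hom ≫ (s ⊗ₘ mu H) ≫ mu H = piR H ▷ H ≫ mu H
  /-- `μ ∘ (H ⊗ μ) ∘ (H ⊗ s ⊗ H) ∘ (δ ⊗ H) = μ ∘ (Π^L ⊗ H)` -/
  a4_5 : Δ[H] ▷ H ≫ (H ◁ s) ▷ H ≫ (α_ H H H).hom ≫ H ◁ mu H ≫ mu H = piL H ▷ H ≫ mu H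
  /-- `μ ∘ (μ ⊗ s) ∘ (H ⊗ δ) = μ ∘ (H ⊗ Π^L)` -/
  a4_6 : H ◁ Δ[H] ≫ (α_ H H H).inv ≫ (mu H ⊗ₘ s) ≫ mu H = H ◁ piL H ≫ mu H
  /-- `μ ∘ (μ ⊗ H) ∘ (H ⊗ s ⊗ H) ∘ (H ⊗ δ) = μ ∘ (H ⊗ Π^R)` -/
  a4_7 : H ◁ Δ[H] ≫ H ◁ (s ▷ H) ≫ (α_ H H H).inv ≫ mu H ▷ H ≫ mu H = H ◁ piR H ≫ mu H

/-- A unital magma and comonoid `H` is a weak Hopf quasigroup: it satisfies (a1), (a2), (a3)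
and has an antipode. -/
structure IsWeakHopfQuasigroup : Prop extends AxiomsA123 H where
  exists_antipode : ∃ s : H ⟶ H, IsAntipode H s

variable {H}

/-- `f = q_R^1 ∘ β ∘ j_L^1`, where `β` is the right Galois morphism. -/
def fMor (L1 : Splitting (omegaL1 H)) (R1 : Splitting (omegaR1 H)) : L1.obj ⟶ R1.obj :=
  L1.j ≫ rightGalois H ≫ R1.q

/-- `g = q_L^2 ∘ γ ∘ j_R^2`, where `γ` is the left Galois morphism. -/
def gMor (R2 : Splitting (omegaR2 H)) (L2 : Splitting (omegaL2 H)) : R2.obj ⟶ L2.obj :=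
  R2.j ≫ leftGalois H ≫ L2.q

end Braided

end WeakHopfQuasigroup

/-!
Call `φ : X ⊗ H ⟶ Y ⊗ H` colinear if it commutes with the coproduct of the last factor; it is then
determined by its first component `(Y ⊗ ε) ∘ φ`. The morphisms `Ω_σ¹` and `β` are colinear with
first components `x y ↦ x Π^σ(y)` and `x y ↦ x y`, and a colinear almost linear morphism is
`omegaOne H s` for a unique `s`. Read in this way, (a4-6), (a4-7) and `s ∗ Π^L = s` say that
`omegaOne H s` inverts `β` between the images of `Ω_L¹` and `Ω_R¹`.

The maps `x y ↦ x Π^σ(y)` must be shown left linear although `μ` is not associative. They are first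
components of contractions of the comonoid `H ⊗ H` against `ε ∘ μ`. Contractions are natural for
comultiplicative morphisms such as `μ`, so an identity between functionals, as in (a2), becomes an
identity between morphisms into `H`.

The remaining conditions say the same of `γ` and `Ω_σ²`, and become the ones above in the category
with reversed tensor product. The two antipodes obtained for `β` and `γ` agree because left and
right inverses do.
-/

namespace WeakHopfQuasigroup

open MonoidalCategory
open scoped ComonObj

universe v u

variable {C : Type u} [Category.{v} C]

section RelativeInverse

namespace Splitting

variable {X : C} {e : X ⟶ X}

theorem nonempty [IsIdempotentComplete C] (he : e ≫ e = e) : Nonempty (Splitting e) := by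
  obtain ⟨Y, j, q, j_q, q_j⟩ := IsIdempotentComplete.idempotents_split X e he
  exact ⟨⟨Y, q, j, q_j, j_q⟩⟩

theorem j_comp (S : Splitting e) : S.j ≫ e = S.j := by
  simp only [← S.q_j, reassoc_of% S.j_q]

theorem comp_q (S : Splitting e) : e ≫ S.q = S.q := by
  simp only [← S.q_j, Category.assoc, S.j_q, Category.comp_id]

end Splitting

/-- `φ` is inverse to `B` between the images of the idempotents `e` and `e'`, and is extended to
all of `Y` through `e'`. -/
structure IsRelativeInverse {X Y : C} (e : X ⟶ X) (e' : Y ⟶ Y) (B : X ⟶ Y) (φ : Y ⟶ X) :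
    Prop where
  hom_inv : B ≫ φ = e
  inv_hom : φ ≫ B = e'
  inv_comp : φ ≫ e = φ

namespace IsRelativeInverse

variable {X Y : C} {e : X ⟶ X} {e' : Y ⟶ Y} {B : X ⟶ Y} {φ : Y ⟶ X}

theorem comp_inv (h : IsRelativeInverse e e' B φ) : e' ≫ φ = φ := by
  rw [← h.inv_hom, Category.assoc, h.hom_inv, h.inv_comp]

theorem mop_iff : IsRelativeInverse e.mop e'.mop B.mop φ.mop ↔ IsRelativeInverse e e' B φ :=
  ⟨fun h => ⟨Quiver.Hom.mop_inj h.hom_inv, Quiver.Hom.mop_inj h.inv_hom,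
      Quiver.Hom.mop_inj h.inv_comp⟩,
    fun h => ⟨congrArg Quiver.Hom.mop h.hom_inv, congrArg Quiver.Hom.mop h.inv_hom,
      congrArg Quiver.Hom.mop h.inv_comp⟩⟩

theorem iff_of_splitting (L : Splitting e) (R : Splitting e') (comp_hom : e ≫ B = B)
    (hom_comp : B ≫ e' = B) : IsRelativeInverse e e' B φ ↔
      ∃ _ : IsIso (L.j ≫ B ≫ R.q), R.q ≫ inv (L.j ≫ B ≫ R.q) ≫ L.j = φ := by
  have q_comp : L.q ≫ L.j ≫ B ≫ R.q = B ≫ R.q := by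
    rw [reassoc_of% L.q_j, reassoc_of% comp_hom]
  have comp_j : (L.j ≫ B ≫ R.q) ≫ R.j = L.j ≫ B := by
    rw [Category.assoc, Category.assoc, R.q_j, hom_comp]
  generalize L.j ≫ B ≫ R.q = f at q_comp comp_j
  constructor
  · intro h
    have hom_inv : f ≫ R.j ≫ φ ≫ L.q = 𝟙 _ := by
      rw [reassoc_of% comp_j, reassoc_of% h.hom_inv, L.comp_q, L.j_q]
    have inv_hom : (R.j ≫ φ ≫ L.q) ≫ f = 𝟙 _ := by
      rw [Category.assoc, Category.assoc, q_comp, reassoc_of% h.inv_hom, R.comp_q, R.j_q]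
    have isIso : IsIso f := ⟨_, hom_inv, inv_hom⟩
    refine ⟨isIso, ?_⟩
    rw [IsIso.inv_eq_of_hom_inv_id hom_inv, Category.assoc, Category.assoc, L.q_j, h.inv_comp,
      reassoc_of% R.q_j, h.comp_inv]
  · rintro ⟨isIso, rfl⟩
    refine ⟨?_, ?_, ?_⟩
    · rw [← reassoc_of% q_comp, IsIso.hom_inv_id_assoc, L.q_j]
    · rw [Category.assoc, Category.assoc, ← comp_j, IsIso.inv_hom_id_assoc, R.q_j]
    · rw [Category.assoc, Category.assoc, L.j_comp]

theorem exists_iff_of_splitting (L : Splitting e) (R : Splitting e') (comp_hom : e ≫ B = B)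
    (hom_comp : B ≫ e' = B) (P : (Y ⟶ X) → Prop) :
    (∃ φ, IsRelativeInverse e e' B φ ∧ P φ) ↔
      ∃ _ : IsIso (L.j ≫ B ≫ R.q), P (R.q ≫ inv (L.j ≫ B ≫ R.q) ≫ L.j) := by
  simp only [iff_of_splitting L R comp_hom hom_comp]
  exact ⟨fun ⟨_, ⟨isIso, h⟩, hP⟩ => ⟨isIso, h ▸ hP⟩, fun ⟨isIso, hP⟩ => ⟨_, ⟨isIso, rfl⟩, hP⟩⟩

end IsRelativeInverse

end RelativeInverse

variable [MonoidalCategory C]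

section Fst

variable {A B D : C} [ComonObj D]

/-- The projection `a ⊗ d ↦ a ε(d)`. -/
def fst (A D : C) [ComonObj D] : A ⊗ D ⟶ A := A ◁ ε[D] ≫ (ρ_ A).hom

theorem whiskerRight_comp_fst (f : A ⟶ B) : f ▷ D ≫ fst B D = fst A D ≫ f := by
  rw [fst, fst, ← whisker_exchange_assoc, rightUnitor_naturality, Category.assoc]

theorem associator_hom_comp_whiskerLeft_fst (A B D : C) [ComonObj D] :
    (α_ A B D).hom ≫ A ◁ fst B D = fst (A ⊗ B) D := by
  rw [fst, fst]
  monoidal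

end Fst

section Contraction

/-- A morphism of comonoids that need not preserve the counit. -/
def IsComultiplicative {A B : C} [ComonObj A] [ComonObj B] (f : A ⟶ B) : Prop :=
  f ≫ Δ[B] = Δ[A] ≫ (f ⊗ₘ f)

namespace IsComultiplicative

variable [BraidedCategory C] {A B : C} [ComonObj A] [ComonObj B] {f : A ⟶ B}

theorem whiskerRight (hf : IsComultiplicative f) (D : C) [ComonObj D] :
    IsComultiplicative (f ▷ D) := by
  rw [IsComultiplicative, Comon.tensorObj_comul, Comon.tensorObj_comul, Category.assoc,
    ← tensorμ_natural_left, whiskerRight_comp_tensorHom_assoc, hf,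
    tensorHom_comp_whiskerRight_assoc]

theorem whiskerLeft (D : C) [ComonObj D] (hf : IsComultiplicative f) :
    IsComultiplicative (D ◁ f) := by
  rw [IsComultiplicative, Comon.tensorObj_comul, Comon.tensorObj_comul, Category.assoc,
    ← tensorμ_natural_right, whiskerLeft_comp_tensorHom_assoc, hf,
    tensorHom_comp_whiskerLeft_assoc]

theorem associator_hom (A B D : C) [ComonObj A] [ComonObj B] [ComonObj D] :
    IsComultiplicative (α_ A B D).hom := by
  simp only [IsComultiplicative, Comon.tensorObj_comul]
  calc (α_ A B D).hom ≫ (Δ[A] ⊗ₘ ((Δ[B] ⊗ₘ Δ[D]) ≫ tensorμ B B D D)) ≫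
        tensorμ A A (B ⊗ D) (B ⊗ D)
    _ = ((Δ[A] ⊗ₘ Δ[B]) ⊗ₘ Δ[D]) ≫ (α_ (A ⊗ A) (B ⊗ B) (D ⊗ D)).hom ≫
        (A ⊗ A) ◁ tensorμ B B D D ≫ tensorμ A A (B ⊗ D) (B ⊗ D) := by
      rw [associator_naturality_assoc, tensorHom_comp_whiskerLeft_assoc]
    _ = ((((Δ[A] ⊗ₘ Δ[B]) ≫ tensorμ A A B B) ⊗ₘ Δ[D]) ≫ tensorμ (A ⊗ B) (A ⊗ B) D D) ≫
        ((α_ A B D).hom ⊗ₘ (α_ A B D).hom) := by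
      rw [← tensor_associativity, tensorHom_comp_whiskerRight_assoc, Category.assoc]

theorem fst (A B : C) [ComonObj A] [ComonObj B] : IsComultiplicative (fst A B) := by
  rw [IsComultiplicative, Comon.tensorObj_comul, WeakHopfQuasigroup.fst]
  calc (A ◁ ε[B] ≫ (ρ_ A).hom) ≫ Δ[A]
    _ = (Δ[A] ⊗ₘ ε[B]) ≫ (ρ_ (A ⊗ A)).hom := by
      rw [tensorHom_def', Category.assoc, Category.assoc, rightUnitor_naturality]
    _ = (Δ[A] ⊗ₘ (Δ[B] ≫ (ε[B] ⊗ₘ ε[B]))) ≫ tensorμ A A (𝟙_ C) (𝟙_ C) ≫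
        ((ρ_ A).hom ⊗ₘ (ρ_ A).hom) := by
      rw [ComonObj.counit_comul_hom, tensor_right_unitality, tensorHom_comp_whiskerLeft_assoc]
    _ = ((Δ[A] ⊗ₘ Δ[B]) ≫ tensorμ A A B B) ≫
        ((A ◁ ε[B] ≫ (ρ_ A).hom) ⊗ₘ (A ◁ ε[B] ≫ (ρ_ A).hom)) := by
      rw [← tensorHom_comp_whiskerLeft_assoc, tensorμ_natural_right_assoc,
        tensorHom_comp_tensorHom, Category.assoc]

end IsComultiplicative

/-- A way of letting functionals act on their comonoid which is natural in the comonoid. There are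
two of them: on the left, `Contraction.left`, and on the right, `Contraction.right`. -/
structure Contraction (C : Type u) [Category.{v} C] [MonoidalCategory C] [BraidedCategory C] where
  act : ∀ {A : C} [ComonObj A], (A ⟶ 𝟙_ C) → (A ⟶ A)
  act_counit : ∀ (A : C) [ComonObj A], act ε[A] = 𝟙 A
  act_comp : ∀ {A B : C} [ComonObj A] [ComonObj B] {f : A ⟶ B}, IsComultiplicative f →
    ∀ e : B ⟶ 𝟙_ C, act (f ≫ e) ≫ f = f ≫ act e
  whiskerLeft_act_comp_act : ∀ {A B : C} [ComonObj A] [ComonObj B] (e : B ⟶ 𝟙_ C)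
    (e' : A ⊗ B ⟶ 𝟙_ C), A ◁ act e ≫ act e' = act (A ◁ act e ≫ e')

theorem contractLeft_comul {A : C} [ComonObj A] (e : A ⟶ 𝟙_ C) :
    (Δ[A] ≫ e ▷ A ≫ (λ_ A).hom) ≫ Δ[A] = Δ[A] ≫ (Δ[A] ≫ e ▷ A ≫ (λ_ A).hom) ▷ A := by
  rw [Category.assoc, Category.assoc, ← leftUnitor_naturality, ← whisker_exchange_assoc,
    ComonObj.comul_assoc_assoc]
  monoidal

theorem contractRight_comul {A : C} [ComonObj A] (e : A ⟶ 𝟙_ C) :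
    (Δ[A] ≫ A ◁ e ≫ (ρ_ A).hom) ≫ Δ[A] = Δ[A] ≫ A ◁ (Δ[A] ≫ A ◁ e ≫ (ρ_ A).hom) := by
  rw [Category.assoc, Category.assoc, ← rightUnitor_naturality, whisker_exchange_assoc,
    ComonObj.comul_assoc_flip_assoc]
  monoidal

variable [BraidedCategory C]

theorem whiskerLeft_comp_comul_of_comp_comul_eq_whiskerRight (A : C) {B : C} [ComonObj A]
    [ComonObj B] {f : B ⟶ B} (hf : f ≫ Δ[B] = Δ[B] ≫ f ▷ B) :
    A ◁ f ≫ Δ[A ⊗ B] = Δ[A ⊗ B] ≫ (A ◁ f) ▷ (A ⊗ B) := by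
  have natural := tensorμ_natural_right A A f (𝟙 B)
  rw [tensorHom_id, whiskerLeft_id, tensorHom_id] at natural
  simp only [Comon.tensorObj_comul, Category.assoc, whiskerLeft_comp_tensorHom_assoc, hf,
    ← tensorHom_comp_whiskerLeft_assoc, natural]

theorem whiskerLeft_comp_comul_of_comp_comul_eq_whiskerLeft (A : C) {B : C} [ComonObj A]
    [ComonObj B] {f : B ⟶ B} (hf : f ≫ Δ[B] = Δ[B] ≫ B ◁ f) :
    A ◁ f ≫ Δ[A ⊗ B] = Δ[A ⊗ B] ≫ (A ⊗ B) ◁ A ◁ f := by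
  have natural := tensorμ_natural_right A A (𝟙 B) f
  rw [id_tensorHom, whiskerLeft_id, id_tensorHom] at natural
  simp only [Comon.tensorObj_comul, Category.assoc, whiskerLeft_comp_tensorHom_assoc, hf,
    ← tensorHom_comp_whiskerLeft_assoc, natural]

namespace Contraction

/-- The action `x ↦ e(x₁) x₂` of a functional `e`. -/
def left : Contraction C where
  act {A} _ e := Δ[A] ≫ e ▷ A ≫ (λ_ A).hom
  act_counit A _ := by rw [ComonObj.counit_comul_assoc, Iso.inv_hom_id]
  act_comp {A B} _ _ f hf e := by
    simp only [reassoc_of% (show f ≫ Δ[B] = _ from hf), tensorHom_def', Category.assoc,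
      leftUnitor_naturality, comp_whiskerRight, whisker_exchange_assoc]
  whiskerLeft_act_comp_act {A B} _ _ e e' := by
    have h := whiskerLeft_comp_comul_of_comp_comul_eq_whiskerRight A (contractLeft_comul e)
    rw [reassoc_of% h, comp_whiskerRight_assoc]

/-- The action `x ↦ x₁ e(x₂)` of a functional `e`. -/
def right : Contraction C where
  act {A} _ e := Δ[A] ≫ A ◁ e ≫ (ρ_ A).hom
  act_counit A _ := by rw [ComonObj.comul_counit_assoc, Iso.inv_hom_id]
  act_comp {A B} _ _ f hf e := by
    simp only [reassoc_of% (show f ≫ Δ[B] = _ from hf), MonoidalCategory.tensorHom_def,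
      Category.assoc, rightUnitor_naturality, MonoidalCategory.whiskerLeft_comp,
      ← whisker_exchange_assoc]
  whiskerLeft_act_comp_act {A B} _ _ e e' := by
    have h := whiskerLeft_comp_comul_of_comp_comul_eq_whiskerLeft A (contractRight_comul e)
    rw [reassoc_of% h, MonoidalCategory.whiskerLeft_comp_assoc]

end Contraction

end Contraction

section LeftLinear

variable {H : C} [UnitalMagmaObj H]

/-- `k (x y ⊗ z) = x k (y ⊗ z)`. -/
def LeftLinear (k : H ⊗ H ⟶ H) : Prop :=
  mu H ▷ H ≫ k = (α_ H H H).hom ≫ H ◁ k ≫ mu H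

/-- The endomorphism `k (1 ⊗ -)` of `H`. -/
def evalOne (k : H ⊗ H ⟶ H) : H ⟶ H := (λ_ H).inv ≫ eta H ▷ H ≫ k

theorem evalOne_whiskerLeft_comp_mu (p : H ⟶ H) : evalOne (H ◁ p ≫ mu H) = p := by
  rw [evalOne, ← whisker_exchange_assoc, UnitalMagmaObj.one_mul, leftUnitor_naturality,
    Iso.inv_hom_id_assoc]

namespace LeftLinear

variable {k : H ⊗ H ⟶ H}

theorem whiskerLeft_evalOne_comp_mu (hk : LeftLinear k) : H ◁ evalOne k ≫ mu H = k := by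
  have comp_mu : H ◁ k ≫ mu H = (α_ H H H).inv ≫ mu H ▷ H ≫ k :=
    ((Iso.inv_comp_eq _).2 hk).symm
  rw [evalOne, MonoidalCategory.whiskerLeft_comp_assoc, MonoidalCategory.whiskerLeft_comp_assoc,
    comp_mu, associator_inv_naturality_middle_assoc, ← comp_whiskerRight_assoc,
    UnitalMagmaObj.mul_one]
  monoidal

theorem whiskerLeft_comp (hk : LeftLinear k) (p : H ⟶ H) : LeftLinear (H ◁ p ≫ k) := by
  rw [LeftLinear, ← whisker_exchange_assoc, hk, MonoidalCategory.whiskerLeft_comp,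
    tensor_whiskerLeft]
  simp only [Category.assoc, Iso.inv_hom_id_assoc]

end LeftLinear

end LeftLinear

section RightColinear

variable {X Y Z H : C} [ComonObj H]

/-- The right `H`-colinear morphism `x ⊗ h ↦ k (x ⊗ h₁) ⊗ h₂` with first component `k`. -/
def rightExtend (k : X ⊗ H ⟶ Y) : X ⊗ H ⟶ Y ⊗ H := X ◁ Δ[H] ≫ (α_ X H H).inv ≫ k ▷ H

/-- Colinearity for the right `H`-coactions given by the coproduct on the last factor. -/
def IsRightColinear (φ : X ⊗ H ⟶ Y ⊗ H) : Prop :=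
  rightExtend φ = φ ≫ Y ◁ Δ[H] ≫ (α_ Y H H).inv

theorem rightExtend_comp (k : X ⊗ H ⟶ Y) (f : Y ⟶ Z) :
    rightExtend (k ≫ f) = rightExtend k ≫ f ▷ H := by
  simp only [rightExtend, comp_whiskerRight, Category.assoc]

theorem rightExtend_comp_fst (k : X ⊗ H ⟶ Y) : rightExtend k ≫ fst Y H = k := by
  rw [rightExtend, Category.assoc, Category.assoc, whiskerRight_comp_fst, fst, tensor_whiskerLeft]
  simp [← MonoidalCategory.whiskerLeft_comp_assoc]

theorem isRightColinear_rightExtend (k : X ⊗ H ⟶ Y) : IsRightColinear (rightExtend k) := by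
  have coassoc : X ◁ Δ[H] ≫ X ◁ (H ◁ Δ[H]) = X ◁ Δ[H] ≫ X ◁ (Δ[H] ▷ H) ≫ X ◁ (α_ H H H).hom := by
    simp only [← MonoidalCategory.whiskerLeft_comp, ComonObj.comul_assoc]
  simp only [IsRightColinear, rightExtend, Category.assoc, comp_whiskerRight]
  rw [← whisker_exchange_assoc, tensor_whiskerLeft]
  simp only [Category.assoc, Iso.inv_hom_id_assoc, reassoc_of% coassoc]
  monoidal

namespace IsRightColinear

variable {φ : X ⊗ H ⟶ Y ⊗ H} {ψ : Y ⊗ H ⟶ Z ⊗ H}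

theorem rightExtend_comp_fst (hφ : IsRightColinear φ) : rightExtend (φ ≫ fst Y H) = φ := by
  rw [WeakHopfQuasigroup.rightExtend_comp, hφ, fst, Category.assoc, Category.assoc,
    comp_whiskerRight, ← associator_inv_naturality_middle_assoc,
    ← MonoidalCategory.whiskerLeft_comp_assoc, ComonObj.counit_comul]
  monoidal

theorem rightExtend_comp (hφ : IsRightColinear φ) (g : Y ⊗ H ⟶ Z) :
    rightExtend (φ ≫ g) = φ ≫ rightExtend g := by
  rw [WeakHopfQuasigroup.rightExtend_comp, hφ, rightExtend, Category.assoc, Category.assoc]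

theorem comp (hφ : IsRightColinear φ) (hψ : IsRightColinear ψ) : IsRightColinear (φ ≫ ψ) := by
  rw [IsRightColinear, hφ.rightExtend_comp, hψ, Category.assoc]

theorem ext {φ' : X ⊗ H ⟶ Y ⊗ H} (hφ : IsRightColinear φ) (hφ' : IsRightColinear φ')
    (h : φ ≫ fst Y H = φ' ≫ fst Y H) : φ = φ' := by
  rw [← hφ.rightExtend_comp_fst, h, hφ'.rightExtend_comp_fst]

end IsRightColinear

theorem IsRelativeInverse.isRightColinear {e : X ⊗ H ⟶ X ⊗ H} {e' : Y ⊗ H ⟶ Y ⊗ H}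
    {B : X ⊗ H ⟶ Y ⊗ H} {φ : Y ⊗ H ⟶ X ⊗ H} (h : IsRelativeInverse e e' B φ)
    (he : IsRightColinear e) (he' : IsRightColinear e') (hB : IsRightColinear B) :
    IsRightColinear φ :=
  calc rightExtend φ
    _ = φ ≫ B ≫ rightExtend φ := by
      rw [← Category.assoc, h.inv_hom, ← he'.rightExtend_comp, h.comp_inv]
    _ = φ ≫ rightExtend e := by rw [← hB.rightExtend_comp, h.hom_inv]
    _ = φ ≫ X ◁ Δ[H] ≫ (α_ X H H).inv := by rw [he, ← Category.assoc, h.inv_comp]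

end RightColinear

section Omega

variable {H : C} [UnitalMagmaObj H] [ComonObj H]

theorem omegaOne_eq_rightExtend (p : H ⟶ H) : omegaOne H p = rightExtend (H ◁ p ≫ mu H) := by
  rw [omegaOne, rightExtend, comp_whiskerRight, associator_inv_naturality_middle_assoc]

theorem isRightColinear_omegaOne (p : H ⟶ H) : IsRightColinear (omegaOne H p) :=
  omegaOne_eq_rightExtend p ▸ isRightColinear_rightExtend _

theorem omegaOne_comp_fst (p : H ⟶ H) : omegaOne H p ≫ fst H H = H ◁ p ≫ mu H := by
  rw [omegaOne_eq_rightExtend, rightExtend_comp_fst]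

theorem rightGalois_eq_omegaOne_id : rightGalois H = omegaOne H (𝟙 H) := by
  rw [rightGalois, omegaOne, id_whiskerRight, MonoidalCategory.whiskerLeft_id, Category.id_comp]

theorem omegaOne_inj {p q : H ⟶ H} : omegaOne H p = omegaOne H q ↔ p = q := by
  refine ⟨fun h => ?_, congrArg _⟩
  rw [← evalOne_whiskerLeft_comp_mu p, ← omegaOne_comp_fst, h, omegaOne_comp_fst,
    evalOne_whiskerLeft_comp_mu]

theorem omegaOne_comp_omegaOne_eq_iff {p q r : H ⟶ H} :
    omegaOne H p ≫ omegaOne H q = omegaOne H r ↔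
      omegaOne H p ≫ H ◁ q ≫ mu H = H ◁ r ≫ mu H := by
  rw [← omegaOne_comp_fst, ← omegaOne_comp_fst, ← Category.assoc]
  exact ⟨fun h => by rw [h], ((isRightColinear_omegaOne p).comp (isRightColinear_omegaOne q)).ext
    (isRightColinear_omegaOne r)⟩

theorem LeftLinear.omegaOne_comp_omegaOne {q : H ⟶ H}
    (hq : LeftLinear (H ◁ q ≫ mu H)) (p : H ⟶ H) :
    omegaOne H p ≫ omegaOne H q = omegaOne H (conv H p q) := by
  rw [omegaOne_comp_omegaOne_eq_iff, omegaOne]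
  simp only [Category.assoc, conv]
  rw [hq]
  simp only [MonoidalCategory.tensorHom_def, Category.assoc, MonoidalCategory.whiskerLeft_comp,
    Iso.inv_hom_id_assoc]

theorem evalOne_rightExtend_comp (k : H ⊗ H ⟶ H) (q : H ⟶ H) :
    evalOne (rightExtend k ≫ H ◁ q ≫ mu H) = conv H (evalOne k) q := by
  simp only [evalOne, rightExtend, conv, Category.assoc, MonoidalCategory.tensorHom_def,
    comp_whiskerRight]
  rw [← whisker_exchange_assoc, ← leftUnitor_inv_naturality_assoc,
    associator_inv_naturality_left_assoc]
  monoidal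

theorem evalOne_omegaOne_comp (p q : H ⟶ H) :
    evalOne (omegaOne H p ≫ H ◁ q ≫ mu H) = conv H p q := by
  rw [omegaOne_eq_rightExtend, evalOne_rightExtend_comp, evalOne_whiskerLeft_comp_mu]

theorem conv_eq_of_omegaOne_comp_omegaOne {p q r : H ⟶ H}
    (h : omegaOne H p ≫ omegaOne H q = omegaOne H r) : conv H p q = r := by
  rw [← evalOne_omegaOne_comp, omegaOne_comp_omegaOne_eq_iff.1 h, evalOne_whiskerLeft_comp_mu]

theorem conv_conv_id (r s : H ⟶ H) : conv H (conv H r (𝟙 H)) s =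
    evalOne (omegaOne H r ≫ rightGalois H ≫ H ◁ s ≫ mu H) := by
  have galois : omegaOne H r ≫ rightGalois H = rightExtend (omegaOne H r ≫ H ◁ 𝟙 H ≫ mu H) := by
    rw [(isRightColinear_omegaOne r).rightExtend_comp, ← omegaOne_eq_rightExtend,
      rightGalois_eq_omegaOne_id]
  rw [reassoc_of% galois, evalOne_rightExtend_comp, evalOne_omegaOne_comp]

theorem almostLeftLinear_omegaOne (p : H ⟶ H) : AlmostLeftLinear H (omegaOne H p) := by
  have one_left : (λ_ H).inv ≫ eta H ▷ H ≫ omegaOne H p = Δ[H] ≫ p ▷ H := by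
    simp only [omegaOne]
    rw [← whisker_exchange_assoc, ← whisker_exchange_assoc, ← leftUnitor_inv_naturality_assoc,
      ← leftUnitor_inv_naturality_assoc, associator_inv_naturality_left_assoc,
      ← comp_whiskerRight, UnitalMagmaObj.one_mul]
    monoidal
  rw [AlmostLeftLinear, ← MonoidalCategory.whiskerLeft_comp_assoc,
    ← MonoidalCategory.whiskerLeft_comp_assoc, Category.assoc, one_left,
    MonoidalCategory.whiskerLeft_comp_assoc, omegaOne]

theorem AlmostLeftLinear.eq_omegaOne {φ : H ⊗ H ⟶ H ⊗ H} (hφ : AlmostLeftLinear H φ)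
    (hφ' : IsRightColinear φ) : φ = omegaOne H (evalOne (φ ≫ fst H H)) := by
  refine hφ'.ext (isRightColinear_omegaOne _) ?_
  rw [omegaOne_comp_fst]
  conv_lhs => rw [hφ]
  simp only [Category.assoc, evalOne, whiskerRight_comp_fst, MonoidalCategory.whiskerLeft_comp,
    ← associator_hom_comp_whiskerLeft_fst, Iso.inv_hom_id_assoc]

end Omega

section ContractMul

theorem associator_comp_whiskerLeft_comp {H : C} (d : H ⟶ H ⊗ H) (e : H ⊗ H ⟶ 𝟙_ C) :
    (α_ H H H).hom ≫ H ◁ (d ▷ H ≫ (α_ H H H).hom ≫ H ◁ e ≫ (ρ_ H).hom) ≫ e =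
      (H ◁ d) ▷ H ≫ (α_ H H H).inv ▷ H ≫ (α_ (H ⊗ H) H H).hom ≫ (e ⊗ₘ e) ≫ (λ_ (𝟙_ C)).hom := by
  rw [tensorHom_def', Category.assoc, unitors_equal, rightUnitor_naturality]
  monoidal

variable [BraidedCategory C]

theorem comul_comp_fst_whiskerRight (A B : C) [ComonObj A] [ComonObj B] :
    Δ[A ⊗ B] ≫ fst A B ▷ (A ⊗ B) = Δ[A] ▷ B ≫ (α_ A A B).hom := by
  have natural := tensorμ_natural_right A A ε[B] (𝟙 B)
  rw [tensorHom_id, whiskerLeft_id, tensorHom_id] at natural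
  have unit : A ◁ A ◁ (λ_ B).inv ≫ A ◁ (α_ A (𝟙_ C) B).inv ≫ A ◁ (ρ_ A).hom ▷ B = 𝟙 _ := by
    monoidal
  rw [fst, Comon.tensorObj_comul, comp_whiskerRight, Category.assoc, ← reassoc_of% natural,
    tensorHom_comp_whiskerLeft_assoc, ComonObj.counit_comul]
  simp [tensorμ, MonoidalCategory.tensorHom_def, unit]

theorem comul_comp_whiskerLeft_fst (A B : C) [ComonObj A] [ComonObj B] :
    Δ[A ⊗ B] ≫ (A ⊗ B) ◁ fst A B =
      Δ[A] ▷ B ≫ (α_ A A B).hom ≫ A ◁ (β_ A B).hom ≫ (α_ A B A).inv := by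
  have natural := tensorμ_natural_right A A (𝟙 B) ε[B]
  rw [id_tensorHom, whiskerLeft_id, id_tensorHom] at natural
  rw [fst, Comon.tensorObj_comul, MonoidalCategory.whiskerLeft_comp, Category.assoc,
    ← reassoc_of% natural, tensorHom_comp_whiskerLeft_assoc, ComonObj.comul_counit]
  simp [tensorμ, MonoidalCategory.tensorHom_def]

theorem whiskerLeft_braiding_comp_whiskerRight {A B D : C} (e : A ⊗ D ⟶ 𝟙_ C) :
    A ◁ (β_ B D).hom ≫ (α_ A D B).inv ≫ e ▷ B ≫ (λ_ B).hom =
      (α_ A B D).inv ≫ (β_ B A).inv ▷ D ≫ (α_ B A D).hom ≫ B ◁ e ≫ (ρ_ B).hom := by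
  have h : B ◁ e ≫ (ρ_ B).hom = (β_ B (A ⊗ D)).hom ≫ e ▷ B ≫ (λ_ B).hom := by
    rw [← BraidedCategory.braiding_naturality_right_assoc, braiding_leftUnitor]
  rw [h, BraidedCategory.braiding_tensor_right_hom]
  simp only [Category.assoc, Iso.hom_inv_id_assoc, inv_hom_whiskerRight_assoc,
    Iso.inv_hom_id_assoc]

variable {H : C} [UnitalMagmaObj H] [ComonObj H]

theorem AxiomsA123.isComultiplicative_mu (hH : AxiomsA123 H) : IsComultiplicative (mu H) := by
  rw [IsComultiplicative, hH.a1, Comon.tensorObj_comul]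

theorem AxiomsA123.act_comp_mu (hH : AxiomsA123 H) (T : Contraction C) :
    T.act (mu H ≫ ε[H]) ≫ mu H = mu H := by
  rw [T.act_comp hH.isComultiplicative_mu, T.act_counit, Category.comp_id]

namespace Contraction

/-- The first component of the contraction of `H ⊗ H` by `ε ∘ μ`. -/
def contractMul (T : Contraction C) (H : C) [UnitalMagmaObj H] [ComonObj H] : H ⊗ H ⟶ H :=
  T.act (mu H ≫ ε[H]) ≫ fst H H

theorem leftLinear_contractMul (T : Contraction C) (hH : AxiomsA123 H)
    (counit : (α_ H H H).hom ≫ H ◁ T.contractMul H ≫ mu H ≫ ε[H] = mu H ▷ H ≫ mu H ≫ ε[H]) :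
    LeftLinear (T.contractMul H) := by
  have act_mul := T.act_comp (hH.isComultiplicative_mu.whiskerRight H) (mu H ≫ ε[H])
  have act_associator :=
    T.act_comp (.associator_hom H H H) (H ◁ T.contractMul H ≫ mu H ≫ ε[H])
  have act_fst := T.act_comp (.whiskerLeft H (.fst H H)) (mu H ≫ ε[H])
  have act_act := T.whiskerLeft_act_comp_act (A := H) (mu H ≫ ε[H])
    (H ◁ fst H H ≫ mu H ≫ ε[H])
  have fst_mul : mu H ▷ H ≫ fst H H = (α_ H H H).hom ≫ H ◁ fst H H ≫ mu H := by
    rw [whiskerRight_comp_fst, ← associator_hom_comp_whiskerLeft_fst, Category.assoc]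
  calc mu H ▷ H ≫ T.contractMul H
    _ = T.act (mu H ▷ H ≫ mu H ≫ ε[H]) ≫
          (α_ H H H).hom ≫ H ◁ fst H H ≫ mu H := by
      rw [contractMul, reassoc_of% act_mul.symm, fst_mul]
    _ = (α_ H H H).hom ≫ T.act (H ◁ T.contractMul H ≫ mu H ≫ ε[H]) ≫
          H ◁ fst H H ≫ mu H := by
      rw [← counit, reassoc_of% act_associator]
    _ = (α_ H H H).hom ≫ H ◁ T.act (mu H ≫ ε[H]) ≫ H ◁ fst H H ≫
          T.act (mu H ≫ ε[H]) ≫ mu H := by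
      rw [← reassoc_of% act_fst, reassoc_of% act_act, contractMul,
        MonoidalCategory.whiskerLeft_comp_assoc]
    _ = (α_ H H H).hom ≫ H ◁ T.contractMul H ≫ mu H := by
      simp only [hH.act_comp_mu, contractMul, MonoidalCategory.whiskerLeft_comp, Category.assoc]

theorem left_contractMul : left.contractMul H = Δ[H] ▷ H ≫ (α_ H H H).hom ≫ H ◁ (β_ H H).hom ≫
    (α_ H H H).inv ≫ (mu H ≫ ε[H]) ▷ H ≫ (λ_ H).hom := by
  simp only [contractMul, left, Category.assoc]
  rw [← leftUnitor_naturality, ← whisker_exchange_assoc,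
    reassoc_of% comul_comp_whiskerLeft_fst H H]

theorem right_contractMul : right.contractMul H = Δ[H] ▷ H ≫ (α_ H H H).hom ≫
    H ◁ (mu H ≫ ε[H]) ≫ (ρ_ H).hom := by
  simp only [contractMul, right, Category.assoc]
  rw [← rightUnitor_naturality, whisker_exchange_assoc, reassoc_of% comul_comp_fst_whiskerRight H H]

theorem leftLinear_left_contractMul (hH : AxiomsA123 H) : LeftLinear (left.contractMul H) := by
  refine leftLinear_contractMul left hH ?_
  rw [hH.a2_braid, left_contractMul, whiskerLeft_braiding_comp_whiskerRight, Iso.hom_inv_id_assoc,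
    ← comp_whiskerRight_assoc, associator_comp_whiskerLeft_comp]

theorem leftLinear_right_contractMul (hH : AxiomsA123 H) : LeftLinear (right.contractMul H) := by
  refine leftLinear_contractMul right hH ?_
  rw [hH.a2_comul, right_contractMul, associator_comp_whiskerLeft_comp]

end Contraction

end ContractMul

section Projections

variable [BraidedCategory C]

theorem comul_comp_whiskerLeft_snd (A B : C) [ComonObj A] [ComonObj B] :
    Δ[A ⊗ B] ≫ (A ⊗ B) ◁ (ε[A] ▷ B ≫ (λ_ B).hom) = A ◁ Δ[B] ≫ (α_ A B B).inv := by
  have natural := tensorμ_natural_left (𝟙 A) ε[A] B B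
  rw [id_tensorHom, id_whiskerRight, id_tensorHom] at natural
  have unit : A ◁ (ρ_ B).inv ▷ B ≫ A ◁ (α_ B (𝟙_ C) B).hom ≫ A ◁ B ◁ (λ_ B).hom = 𝟙 _ := by
    monoidal
  rw [Comon.tensorObj_comul, MonoidalCategory.whiskerLeft_comp, Category.assoc,
    ← reassoc_of% natural, tensorHom_comp_whiskerRight_assoc, ComonObj.comul_counit]
  simp [tensorμ, MonoidalCategory.tensorHom_def, reassoc_of% unit]

theorem Contraction.isRightColinear_left_act {A B : C} [ComonObj A] [ComonObj B]
    (e : A ⊗ B ⟶ 𝟙_ C) : IsRightColinear (left.act e) := by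
  have comul : left.act e ≫ Δ[A ⊗ B] = Δ[A ⊗ B] ≫ left.act e ▷ (A ⊗ B) := contractLeft_comul e
  rw [IsRightColinear, rightExtend, ← comul_comp_whiskerLeft_snd,
    ← reassoc_of% comul_comp_whiskerLeft_snd, whisker_exchange, ← reassoc_of% comul]

theorem Contraction.left_act_comp_act {A : C} [ComonObj A] (e e' : A ⟶ 𝟙_ C) :
    left.act e ≫ left.act e' = left.act (left.act e ≫ e') := by
  have comul : left.act e ≫ Δ[A] = Δ[A] ≫ left.act e ▷ A := contractLeft_comul e
  change left.act e ≫ Δ[A] ≫ e' ▷ A ≫ (λ_ A).hom = Δ[A] ≫ (left.act e ≫ e') ▷ A ≫ (λ_ A).hom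
  rw [reassoc_of% comul, comp_whiskerRight_assoc]

variable {H : C} [UnitalMagmaObj H] [ComonObj H]

theorem piL_eq_evalOne : piL H = evalOne (Contraction.left.contractMul H) := by
  rw [piL, evalOne, Contraction.left_contractMul, comp_whiskerRight_assoc]

namespace AxiomsA123

theorem whiskerLeft_piL_comp_mu (hH : AxiomsA123 H) :
    H ◁ piL H ≫ mu H = Contraction.left.contractMul H := by
  rw [piL_eq_evalOne, (Contraction.leftLinear_left_contractMul hH).whiskerLeft_evalOne_comp_mu]

theorem leftLinear_piL (hH : AxiomsA123 H) : LeftLinear (H ◁ piL H ≫ mu H) := by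
  rw [hH.whiskerLeft_piL_comp_mu]
  exact Contraction.leftLinear_left_contractMul hH

theorem eta_comul_comp_whiskerRight (hH : AxiomsA123 H) :
    (eta H ≫ Δ[H]) ≫ evalOne (Contraction.right.contractMul H) ▷ H = eta H ≫ Δ[H] := by
  have contract := congrArg (· ≫ fst H H ▷ H) hH.a3_mul
  have counit : Δ[H] ≫ Δ[H] ▷ H ≫ fst H H ▷ H = Δ[H] := by
    rw [← comp_whiskerRight, fst, ComonObj.comul_counit_assoc, Iso.inv_hom_id, id_whiskerRight,
      Category.comp_id]
  simp only [Category.assoc, counit, tensorHom_def', ← leftUnitor_inv_naturality_assoc]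
    at contract
  refine Eq.trans ?_ contract.symm
  rw [evalOne, Contraction.right_contractMul, fst]
  monoidal

theorem piR_comp_evalOne (hH : AxiomsA123 H) :
    piR H ≫ evalOne (Contraction.right.contractMul H) = piR H := by
  simp only [piR, Category.assoc]
  rw [← rightUnitor_naturality, whisker_exchange_assoc, ← associator_naturality_left_assoc,
    ← comp_whiskerRight_assoc, ← BraidedCategory.braiding_naturality_right,
    comp_whiskerRight_assoc, ← associator_inv_naturality_middle_assoc,
    ← MonoidalCategory.whiskerLeft_comp_assoc, hH.eta_comul_comp_whiskerRight]

theorem leftLinear_piR (hH : AxiomsA123 H) : LeftLinear (H ◁ piR H ≫ mu H) := by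
  have right := Contraction.leftLinear_right_contractMul hH
  rw [← hH.piR_comp_evalOne, MonoidalCategory.whiskerLeft_comp, Category.assoc,
    right.whiskerLeft_evalOne_comp_mu]
  exact right.whiskerLeft_comp (piR H)

theorem omegaL1_eq_act (hH : AxiomsA123 H) :
    omegaL1 H = Contraction.left.act (mu H ≫ ε[H]) := by
  rw [omegaL1, omegaOne_eq_rightExtend, hH.whiskerLeft_piL_comp_mu, Contraction.contractMul,
    (Contraction.isRightColinear_left_act _).rightExtend_comp_fst]

theorem omegaL1_comp_mu (hH : AxiomsA123 H) : omegaL1 H ≫ mu H = mu H := by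
  rw [hH.omegaL1_eq_act, hH.act_comp_mu]

theorem omegaL1_comp_rightGalois (hH : AxiomsA123 H) :
    omegaL1 H ≫ rightGalois H = rightGalois H := by
  rw [rightGalois_eq_omegaOne_id, omegaL1, omegaOne_comp_omegaOne_eq_iff,
    MonoidalCategory.whiskerLeft_id, Category.id_comp]
  exact hH.omegaL1_comp_mu

theorem omegaL1_idem (hH : AxiomsA123 H) : omegaL1 H ≫ omegaL1 H = omegaL1 H := by
  rw [hH.omegaL1_eq_act, Contraction.left_act_comp_act, reassoc_of% hH.act_comp_mu]

theorem conv_piL_piL (hH : AxiomsA123 H) : conv H (piL H) (piL H) = piL H :=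
  conv_eq_of_omegaOne_comp_omegaOne hH.omegaL1_idem

theorem conv_piL_id (hH : AxiomsA123 H) : conv H (piL H) (𝟙 H) = 𝟙 H :=
  conv_eq_of_omegaOne_comp_omegaOne
    (by rw [← rightGalois_eq_omegaOne_id]; exact hH.omegaL1_comp_rightGalois)

end AxiomsA123

end Projections

section Mirror

open MonoidalOpposite

instance instUnitalMagmaObjMop (H : C) [UnitalMagmaObj H] : UnitalMagmaObj (mop H) where
  one := (eta H).mop
  mul := (mu H).mop
  one_mul := congrArg Quiver.Hom.mop UnitalMagmaObj.mul_one
  mul_one := congrArg Quiver.Hom.mop UnitalMagmaObj.one_mul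

instance instComonObjMop (H : C) [ComonObj H] : ComonObj (mop H) where
  counit := ε[H].mop
  comul := Δ[H].mop
  counit_comul := congrArg Quiver.Hom.mop (ComonObj.comul_counit H)
  comul_counit := congrArg Quiver.Hom.mop (ComonObj.counit_comul H)
  comul_assoc := congrArg Quiver.Hom.mop
    (by rw [ComonObj.comul_assoc_assoc, Iso.hom_inv_id, Category.comp_id] :
      Δ[H] ≫ Δ[H] ▷ H = Δ[H] ≫ H ◁ Δ[H] ≫ (α_ H H H).inv)

theorem comp_tensorHom_reassoc {H : C} (d : H ⟶ H ⊗ H) (e : H ⊗ H ⟶ 𝟙_ C) :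
    (α_ H H H).inv ≫ (H ◁ d) ▷ H ≫ (α_ H H H).inv ▷ H ≫ (α_ (H ⊗ H) H H).hom ≫ (e ⊗ₘ e) ≫
        (λ_ (𝟙_ C)).hom =
      H ◁ (d ▷ H) ≫ H ◁ (α_ H H H).hom ≫ (α_ H H (H ⊗ H)).inv ≫ (e ⊗ₘ e) ≫ (ρ_ (𝟙_ C)).hom := by
  rw [unitors_equal]
  monoidal

theorem tensorHom_comp_reassoc {H : C} (w : 𝟙_ C ⟶ H ⊗ H) (m : H ⊗ H ⟶ H) :
    ((λ_ (𝟙_ C)).inv ≫ (w ⊗ₘ w) ≫ (α_ (H ⊗ H) H H).inv ≫ (α_ H H H).hom ▷ H ≫ (H ◁ m) ▷ H) ≫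
        (α_ H H H).hom =
      (ρ_ (𝟙_ C)).inv ≫ (w ⊗ₘ w) ≫ (α_ H H (H ⊗ H)).hom ≫ H ◁ (α_ H H H).inv ≫ H ◁ (m ▷ H) := by
  rw [unitors_inv_equal]
  monoidal

theorem comul_one_reassoc {H : C} [UnitalMagmaObj H] [ComonObj H] :
    eta H ≫ Δ[H] ≫ H ◁ Δ[H] = (eta H ≫ Δ[H] ≫ Δ[H] ▷ H) ≫ (α_ H H H).hom := by
  simp only [Category.assoc, ComonObj.comul_assoc]

section Magma

variable {H : C} [UnitalMagmaObj H]

theorem almostLeftLinear_mop {φ : H ⊗ H ⟶ H ⊗ H} :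
    AlmostLeftLinear (mop H) φ.mop ↔ AlmostRightLinear H φ :=
  Quiver.Hom.mop_inj.eq_iff (a := φ)

variable [ComonObj H]

theorem conv_mop (f g : H ⟶ H) : conv (mop H) f.mop g.mop = (conv H g f).mop := rfl

theorem omegaOne_mop (p : H ⟶ H) : omegaOne (mop H) p.mop = (omegaTwo H p).mop := rfl

theorem rightGalois_mop : rightGalois (mop H) = (leftGalois H).mop := rfl

variable [BraidedCategory C]

theorem piL_mop : piL (mop H) = (piR H).mop := rfl

theorem piR_mop : piR (mop H) = (piL H).mop := rfl

theorem omegaL1_mop : omegaL1 (mop H) = (omegaR2 H).mop := rfl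

theorem omegaR1_mop : omegaR1 (mop H) = (omegaL2 H).mop := rfl

theorem AxiomsA123.mop (hH : AxiomsA123 H) : AxiomsA123 (mop H) where
  a1 := by
    have unmop_tensorμ : (tensorμ (.mop H) (.mop H) (.mop H) (.mop H)).unmop = tensorμ H H H H := by
      simp [tensorμ]
    refine MonoidalOpposite.hom_ext (hH.a1.trans ?_)
    rw [← unmop_tensorμ]
    rfl
  a2_assoc := MonoidalOpposite.hom_ext ((Iso.eq_inv_comp _).2 hH.a2_assoc.symm)
  a2_comul := MonoidalOpposite.hom_ext <|
    ((Iso.eq_inv_comp _).2 (hH.a2_assoc.symm.trans hH.a2_comul)).trans (comp_tensorHom_reassoc _ _)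
  a2_braid := MonoidalOpposite.hom_ext <|
    ((Iso.eq_inv_comp _).2 (hH.a2_assoc.symm.trans hH.a2_braid)).trans (comp_tensorHom_reassoc _ _)
  a3_mul := MonoidalOpposite.hom_ext <|
    comul_one_reassoc.trans ((congrArg (· ≫ (α_ H H H).hom) hH.a3_mul).trans
      (tensorHom_comp_reassoc (eta H ≫ Δ[H]) (mu H)))
  a3_braid := MonoidalOpposite.hom_ext <|
    comul_one_reassoc.trans ((congrArg (· ≫ (α_ H H H).hom) hH.a3_braid).trans
      (tensorHom_comp_reassoc _ _))

end Magma

end Mirror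

section Idempotents

open MonoidalOpposite

variable [BraidedCategory C] {H : C} [UnitalMagmaObj H] [ComonObj H]

namespace AxiomsA123

theorem conv_piR_piR (hH : AxiomsA123 H) : conv H (piR H) (piR H) = piR H := by
  simpa only [piL_mop, conv_mop, Quiver.Hom.mop_inj.eq_iff] using hH.mop.conv_piL_piL

theorem conv_id_piR (hH : AxiomsA123 H) : conv H (𝟙 H) (piR H) = 𝟙 H := by
  simpa only [piL_mop, ← mop_id, conv_mop, Quiver.Hom.mop_inj.eq_iff] using hH.mop.conv_piL_id

theorem omegaR1_idem (hH : AxiomsA123 H) : omegaR1 H ≫ omegaR1 H = omegaR1 H := by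
  rw [omegaR1, hH.leftLinear_piR.omegaOne_comp_omegaOne, hH.conv_piR_piR]

theorem omegaL2_idem (hH : AxiomsA123 H) : omegaL2 H ≫ omegaL2 H = omegaL2 H := by
  simpa only [omegaR1_mop, ← mop_comp, Quiver.Hom.mop_inj.eq_iff] using hH.mop.omegaR1_idem

theorem omegaR2_idem (hH : AxiomsA123 H) : omegaR2 H ≫ omegaR2 H = omegaR2 H := by
  simpa only [omegaL1_mop, ← mop_comp, Quiver.Hom.mop_inj.eq_iff] using hH.mop.omegaL1_idem

theorem rightGalois_comp_omegaR1 (hH : AxiomsA123 H) :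
    rightGalois H ≫ omegaR1 H = rightGalois H := by
  rw [rightGalois_eq_omegaOne_id, omegaR1, hH.leftLinear_piR.omegaOne_comp_omegaOne,
    hH.conv_id_piR]

theorem omegaR2_comp_leftGalois (hH : AxiomsA123 H) :
    omegaR2 H ≫ leftGalois H = leftGalois H := by
  simpa only [omegaL1_mop, rightGalois_mop, ← mop_comp, Quiver.Hom.mop_inj.eq_iff] using
    hH.mop.omegaL1_comp_rightGalois

theorem leftGalois_comp_omegaL2 (hH : AxiomsA123 H) :
    leftGalois H ≫ omegaL2 H = leftGalois H := by
  simpa only [omegaR1_mop, rightGalois_mop, ← mop_comp, Quiver.Hom.mop_inj.eq_iff] using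
    hH.mop.rightGalois_comp_omegaR1

end AxiomsA123

end Idempotents

section Antipode

open MonoidalOpposite

variable [BraidedCategory C] {H : C} [UnitalMagmaObj H] [ComonObj H] {r s : H ⟶ H}

variable (H) in
/-- `s` is a one-sided antipode: the conditions on an antipode which concern the right Galois
morphism, namely (a4-6), (a4-7) and `s ∗ Π^L = s`, see `AxiomsA123.isRightGaloisInverse_iff`. -/
def IsRightGaloisInverse (s : H ⟶ H) : Prop :=
  IsRelativeInverse (omegaL1 H) (omegaR1 H) (rightGalois H) (omegaOne H s)

variable (H) in
/-- `s` is a one-sided antipode: the conditions on an antipode which concern the left Galois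
morphism, namely (a4-4), (a4-5) and `Π^R ∗ s = s`, see `AxiomsA123.isLeftGaloisInverse_iff`. -/
def IsLeftGaloisInverse (s : H ⟶ H) : Prop :=
  IsRelativeInverse (omegaR2 H) (omegaL2 H) (leftGalois H) (omegaTwo H s)

theorem isRightGaloisInverse_mop :
    IsRightGaloisInverse (mop H) s.mop ↔ IsLeftGaloisInverse H s := by
  rw [IsRightGaloisInverse, omegaL1_mop, omegaR1_mop, rightGalois_mop, omegaOne_mop,
    IsRelativeInverse.mop_iff, IsLeftGaloisInverse]

theorem AxiomsA123.isRightGaloisInverse_iff (hH : AxiomsA123 H) :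
    IsRightGaloisInverse H s ↔
      H ◁ Δ[H] ≫ (α_ H H H).inv ≫ (mu H ⊗ₘ s) ≫ mu H = H ◁ piL H ≫ mu H ∧
      H ◁ Δ[H] ≫ H ◁ (s ▷ H) ≫ (α_ H H H).inv ≫ mu H ▷ H ≫ mu H = H ◁ piR H ≫ mu H ∧
      conv H s (piL H) = s := by
  have hom_inv : rightGalois H ≫ omegaOne H s = omegaL1 H ↔
      H ◁ Δ[H] ≫ (α_ H H H).inv ≫ (mu H ⊗ₘ s) ≫ mu H = H ◁ piL H ≫ mu H := by
    rw [rightGalois_eq_omegaOne_id, omegaL1, omegaOne_comp_omegaOne_eq_iff,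
      ← rightGalois_eq_omegaOne_id]
    simp only [rightGalois, MonoidalCategory.tensorHom_def, Category.assoc]
  have inv_hom : omegaOne H s ≫ rightGalois H = omegaR1 H ↔
      H ◁ Δ[H] ≫ H ◁ (s ▷ H) ≫ (α_ H H H).inv ≫ mu H ▷ H ≫ mu H = H ◁ piR H ≫ mu H := by
    rw [rightGalois_eq_omegaOne_id, omegaR1, omegaOne_comp_omegaOne_eq_iff]
    simp only [omegaOne, MonoidalCategory.whiskerLeft_id, Category.id_comp, Category.assoc]
  have inv_comp : omegaOne H s ≫ omegaL1 H = omegaOne H s ↔ conv H s (piL H) = s := by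
    rw [omegaL1, hH.leftLinear_piL.omegaOne_comp_omegaOne, omegaOne_inj]
  rw [← hom_inv, ← inv_hom, ← inv_comp]
  exact ⟨fun h => ⟨h.hom_inv, h.inv_hom, h.inv_comp⟩, fun h => ⟨h.1, h.2.1, h.2.2⟩⟩

theorem AxiomsA123.isLeftGaloisInverse_iff (hH : AxiomsA123 H) :
    IsLeftGaloisInverse H s ↔
      Δ[H] ▷ H ≫ (α_ H H H).hom ≫ (s ⊗ₘ mu H) ≫ mu H = piR H ▷ H ≫ mu H ∧
      Δ[H] ▷ H ≫ (H ◁ s) ▷ H ≫ (α_ H H H).hom ≫ H ◁ mu H ≫ mu H = piL H ▷ H ≫ mu H ∧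
      conv H (piR H) s = s := by
  rw [← isRightGaloisInverse_mop, hH.mop.isRightGaloisInverse_iff]
  exact and_congr Quiver.Hom.mop_inj.eq_iff
    (and_congr Quiver.Hom.mop_inj.eq_iff Quiver.Hom.mop_inj.eq_iff)

namespace IsRightGaloisInverse

theorem id_conv (hs : IsRightGaloisInverse H s) : conv H (𝟙 H) s = piL H :=
  conv_eq_of_omegaOne_comp_omegaOne (rightGalois_eq_omegaOne_id (H := H) ▸ hs.hom_inv)

theorem conv_id (hs : IsRightGaloisInverse H s) : conv H s (𝟙 H) = piR H :=
  conv_eq_of_omegaOne_comp_omegaOne (rightGalois_eq_omegaOne_id (H := H) ▸ hs.inv_hom)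

theorem conv_piL (hs : IsRightGaloisInverse H s) : conv H s (piL H) = s :=
  conv_eq_of_omegaOne_comp_omegaOne hs.inv_comp

theorem piR_conv (hs : IsRightGaloisInverse H s) : conv H (piR H) s = s :=
  conv_eq_of_omegaOne_comp_omegaOne hs.comp_inv

theorem eq_of_isLeftGaloisInverse (hs : IsRightGaloisInverse H s)
    (hr : IsLeftGaloisInverse H r) : r = s := by
  have hr' := isRightGaloisInverse_mop.2 hr
  have conv_piL : conv H r (piL H) = r := by
    simpa only [piR_mop, conv_mop, Quiver.Hom.mop_inj.eq_iff] using hr'.piR_conv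
  have conv_id : conv H r (𝟙 H) = piR H := by
    simpa only [piL_mop, ← mop_id, conv_mop, Quiver.Hom.mop_inj.eq_iff] using hr'.id_conv
  have galois_comp : rightGalois H ≫ H ◁ s ≫ mu H = H ◁ piL H ≫ mu H := by
    rw [← omegaOne_comp_fst, reassoc_of% hs.hom_inv, omegaL1, omegaOne_comp_fst]
  calc r
    _ = conv H r (piL H) := conv_piL.symm
    _ = evalOne (omegaOne H r ≫ rightGalois H ≫ H ◁ s ≫ mu H) := by
      rw [galois_comp, evalOne_omegaOne_comp]
    _ = conv H (piR H) s := by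
      rw [← conv_conv_id, conv_id]
    _ = s := hs.piR_conv

end IsRightGaloisInverse

theorem AxiomsA123.isAntipode_iff (hH : AxiomsA123 H) :
    IsAntipode H s ↔ IsRightGaloisInverse H s ∧ IsLeftGaloisInverse H s := by
  constructor
  · intro hs
    exact ⟨hH.isRightGaloisInverse_iff.2 ⟨hs.a4_6, hs.a4_7, hs.conv_piL⟩,
      hH.isLeftGaloisInverse_iff.2 ⟨hs.a4_4, hs.a4_5, hs.piR_conv⟩⟩
  · rintro ⟨right, left⟩
    obtain ⟨a4_6, a4_7, conv_piL⟩ := hH.isRightGaloisInverse_iff.1 right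
    obtain ⟨a4_4, a4_5, piR_conv⟩ := hH.isLeftGaloisInverse_iff.1 left
    exact ⟨right.id_conv.symm, right.conv_id.symm, conv_piL, piR_conv, a4_4, a4_5, a4_6, a4_7⟩

theorem AxiomsA123.exists_isAntipode_iff (hH : AxiomsA123 H) :
    (∃ s, IsAntipode H s) ↔
      (∃ s, IsRightGaloisInverse H s) ∧ ∃ s, IsLeftGaloisInverse H s := by
  simp only [hH.isAntipode_iff]
  refine ⟨fun ⟨s, right, left⟩ => ⟨⟨s, right⟩, s, left⟩, ?_⟩
  rintro ⟨⟨s, right⟩, r, left⟩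
  exact ⟨s, right, right.eq_of_isLeftGaloisInverse left ▸ left⟩

variable (H) in
theorem exists_isRightGaloisInverse_iff : (∃ s, IsRightGaloisInverse H s) ↔
    ∃ φ, IsRelativeInverse (omegaL1 H) (omegaR1 H) (rightGalois H) φ ∧ AlmostLeftLinear H φ := by
  constructor
  · rintro ⟨s, hs⟩
    exact ⟨omegaOne H s, hs, almostLeftLinear_omegaOne s⟩
  · rintro ⟨φ, hφ, linear⟩
    have colinear : IsRightColinear φ := hφ.isRightColinear (isRightColinear_omegaOne _)
      (isRightColinear_omegaOne _)
      (rightGalois_eq_omegaOne_id (H := H) ▸ isRightColinear_omegaOne (𝟙 H))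
    exact ⟨_, linear.eq_omegaOne colinear ▸ hφ⟩

variable (H) in
theorem exists_isLeftGaloisInverse_iff : (∃ s, IsLeftGaloisInverse H s) ↔
    ∃ φ, IsRelativeInverse (omegaR2 H) (omegaL2 H) (leftGalois H) φ ∧ AlmostRightLinear H φ :=
  calc (∃ s, IsLeftGaloisInverse H s)
    _ ↔ ∃ s, IsRightGaloisInverse (mop H) s :=
      ⟨fun ⟨s, hs⟩ => ⟨s.mop, isRightGaloisInverse_mop.2 hs⟩,
        fun ⟨s, hs⟩ => ⟨s.unmop, isRightGaloisInverse_mop.1 hs⟩⟩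
    _ ↔ ∃ φ, IsRelativeInverse (omegaL1 (mop H)) (omegaR1 (mop H)) (rightGalois (mop H)) φ ∧
        AlmostLeftLinear (mop H) φ := exists_isRightGaloisInverse_iff (mop H)
    _ ↔ _ :=
      ⟨fun ⟨φ, hφ, linear⟩ =>
          ⟨φ.unmop, IsRelativeInverse.mop_iff.1 hφ, almostLeftLinear_mop.1 linear⟩,
        fun ⟨φ, hφ, linear⟩ =>
          ⟨φ.mop, IsRelativeInverse.mop_iff.2 hφ, almostLeftLinear_mop.2 linear⟩⟩

end Antipode

end WeakHopfQuasigroup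

open WeakHopfQuasigroup in
theorem theorem2_general {C : Type*} [Category* C] [MonoidalCategory C] [BraidedCategory C]
    [IsIdempotentComplete C] (H : C) [UnitalMagmaObj H] [ComonObj H] (hH : AxiomsA123 H) :
    (Nonempty (Splitting (omegaL1 H)) ∧ Nonempty (Splitting (omegaR1 H)) ∧
      Nonempty (Splitting (omegaL2 H)) ∧ Nonempty (Splitting (omegaR2 H))) ∧
    ∀ (L1 : Splitting (omegaL1 H)) (R1 : Splitting (omegaR1 H)) (L2 : Splitting (omegaL2 H))
      (R2 : Splitting (omegaR2 H)),
      IsWeakHopfQuasigroup H ↔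
        ∃ (_ : IsIso (fMor L1 R1)) (_ : IsIso (gMor R2 L2)),
          AlmostLeftLinear H (R1.q ≫ inv (fMor L1 R1) ≫ L1.j) ∧
          AlmostRightLinear H (L2.q ≫ inv (gMor R2 L2) ≫ R2.j) := by
  refine ⟨⟨Splitting.nonempty hH.omegaL1_idem, Splitting.nonempty hH.omegaR1_idem,
    Splitting.nonempty hH.omegaL2_idem, Splitting.nonempty hH.omegaR2_idem⟩, fun L1 R1 L2 R2 => ?_⟩
  have right := IsRelativeInverse.exists_iff_of_splitting L1 R1 hH.omegaL1_comp_rightGalois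
    hH.rightGalois_comp_omegaR1 (AlmostLeftLinear H)
  have left := IsRelativeInverse.exists_iff_of_splitting R2 L2 hH.omegaR2_comp_leftGalois
    hH.leftGalois_comp_omegaL2 (AlmostRightLinear H)
  calc IsWeakHopfQuasigroup H
    _ ↔ ∃ s, IsAntipode H s := ⟨fun h => h.exists_antipode, fun h => ⟨hH, h⟩⟩
    _ ↔ (∃ _ : IsIso (fMor L1 R1), AlmostLeftLinear H (R1.q ≫ inv (fMor L1 R1) ≫ L1.j)) ∧
        ∃ _ : IsIso (gMor R2 L2), AlmostRightLinear H (L2.q ≫ inv (gMor R2 L2) ≫ R2.j) := by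
      rw [hH.exists_isAntipode_iff, exists_isRightGaloisInverse_iff,
        exists_isLeftGaloisInverse_iff, right, left]
      rfl
    _ ↔ _ := ⟨fun ⟨⟨f, linear⟩, g, linear'⟩ => ⟨f, g, linear, linear'⟩,
      fun ⟨f, g, linear, linear'⟩ => ⟨⟨f, linear⟩, g, linear'⟩⟩

theorem theorem2 {C : Type*} [Category* C] [MonoidalCategory C] [BraidedCategory C]
    [Limits.HasEqualizers C] [Limits.HasCoequalizers C]
    (H : C) [WeakHopfQuasigroup.UnitalMagmaObj H] [ComonObj H]
    (hH : WeakHopfQuasigroup.AxiomsA123 H) :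
    (Nonempty (WeakHopfQuasigroup.Splitting (WeakHopfQuasigroup.omegaL1 H)) ∧
      Nonempty (WeakHopfQuasigroup.Splitting (WeakHopfQuasigroup.omegaR1 H)) ∧
      Nonempty (WeakHopfQuasigroup.Splitting (WeakHopfQuasigroup.omegaL2 H)) ∧
      Nonempty (WeakHopfQuasigroup.Splitting (WeakHopfQuasigroup.omegaR2 H))) ∧
    ∀ (L1 : WeakHopfQuasigroup.Splitting (WeakHopfQuasigroup.omegaL1 H))
      (R1 : WeakHopfQuasigroup.Splitting (WeakHopfQuasigroup.omegaR1 H))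
      (L2 : WeakHopfQuasigroup.Splitting (WeakHopfQuasigroup.omegaL2 H))
      (R2 : WeakHopfQuasigroup.Splitting (WeakHopfQuasigroup.omegaR2 H)),
      WeakHopfQuasigroup.IsWeakHopfQuasigroup H ↔
        ∃ (_ : IsIso (WeakHopfQuasigroup.fMor L1 R1))
          (_ : IsIso (WeakHopfQuasigroup.gMor R2 L2)),
          WeakHopfQuasigroup.AlmostLeftLinear H
            (R1.q ≫ inv (WeakHopfQuasigroup.fMor L1 R1) ≫ L1.j) ∧
          WeakHopfQuasigroup.AlmostRightLinear H
            (L2.q ≫ inv (WeakHopfQuasigroup.gMor R2 L2) ≫ R2.j) := by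
  have : IsIdempotentComplete C :=
    (Idempotents.isIdempotentComplete_iff_hasEqualizer_of_id_and_idempotent C).2
      fun _ _ _ => inferInstance
  exact theorem2_general H hH
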